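/- Let $k$ be a field and let $S$ be an integral domain which is essentially of finite type over $k$ (a localization of a finitely generated $k$-algebra). Assume that $S$ is Cohen–Macaulay in the usual sense, i.e. $\operatorname{depth} S_{\mathfrak m}=\dim S_{\mathfrak m}$ for every maximal ideal $\mathfrak m$ of $S$. Let $f\in S$ be a nonzero element which is contained in some maximal ideal $\mathfrak m$ of $S$ with $\dim S_{\mathfrak m}\ge 3$. (If $S$ is local or a finitely generated $k$-algebra, this says that $\dim S\ge 3$ and that $f\neq 0$ is not a unit.) Then the subring $k+fS=\{c+fs : c\in k,\ s\in S\}$ of $S$ is not Cohen–Macaulay in the sense of Hamilton–Marley. Here a sequence $\underline x=x_1,\dots,x_\ell$ in a commutative ring $R$ is a *parameter sequence* if (1) $(\underline x)R\ne R$; (2) $\underline x$ is weakly proregular, i.e. for every $m>0$ there is $n\ge m$ such that the natural maps of Koszul homology $H_i(x_1^n,\dots,x_\ell^n;R)\to H_i(x_1^m,\dots,x_\ell^m;R)$ vanish for all $i\ge 1$; (3) the Čech cohomology satisfies $H^\ell_{\underline x}(R)_{\mathfrak p}\neq 0$ for every prime ideal $\mathfrak p\supseteq(\underline x)R$. It is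 a *strong parameter sequence* if $x_1,\dots,x_i$ is a parameter sequence for all $1\le i\le\ell$. The ring $R$ is *Cohen–Macaulay in the sense of Hamilton–Marley* if every strong parameter sequence on $R$ is a regular sequence on $R$. -/

import Mathlib

universe u v

namespace CohenMacaulay

section Koszul

variable {R : Type u} [CommRing R] {l : ℕ}

/-- The sign `(-1)^#{i ∈ A | i < j}`. -/
def sign (R : Type u) [CommRing R] {l : ℕ} (A : Finset (Fin l)) (j : Fin l) : R :=
  (-1) ^ (A.filter (fun i => i < j)).card

/-- The underlying module of the Koszul complex of a sequence of length `l`: the free module with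
basis `e_A`, `A ⊆ {0, …, l-1}`; a chain is given by its coefficients. -/
abbrev KoszulChain (R : Type u) (l : ℕ) : Type u := Finset (Fin l) → R

/-- The chains of degree `i`: only the `e_A` with `#A = i` occur. -/
def koszulDegree (R : Type u) [CommRing R] (l i : ℕ) : Submodule R (KoszulChain R l) where
  carrier := {c | ∀ A : Finset (Fin l), A.card ≠ i → c A = 0}
  add_mem' := fun {a b} ha hb A hA => by simp [ha A hA, hb A hA]
  zero_mem' := fun A _ => rfl
  smul_mem' := fun r a ha A hA => by simp [ha A hA]

/-- The Koszul differential
`e_B ↦ ∑_{j ∈ B} (-1)^#{i ∈ B | i < j} x_j e_{B \ {j}}`, written on coefficients. -/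
def koszulD (x : Fin l → R) : KoszulChain R l →ₗ[R] KoszulChain R l where
  toFun c A := ∑ j ∈ Aᶜ, sign R A j * x j * c (insert j A)
  map_add' a b := by
    funext A
    simp [mul_add, Finset.sum_add_distrib]
  map_smul' r a := by
    funext A
    simp only [Pi.smul_apply, smul_eq_mul, RingHom.id_apply, Finset.mul_sum]
    exact Finset.sum_congr rfl fun j _ => by ring

/-- The cycles of degree `i` of the Koszul complex of `x`. -/
def koszulCycles (x : Fin l → R) (i : ℕ) : Submodule R (KoszulChain R l) :=
  koszulDegree R l i ⊓ LinearMap.ker (koszulD x)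

/-- The boundaries of degree `i`: the image of the chains of degree `i + 1`. -/
def koszulBoundaries (x : Fin l → R) (i : ℕ) : Submodule R (KoszulChain R l) :=
  (koszulDegree R l (i + 1)).map (koszulD x)

/-- The Koszul homology module `H_i(x; R)`. -/
abbrev KoszulHomology (x : Fin l → R) (i : ℕ) : Type u :=
  koszulCycles x i ⧸ (koszulBoundaries x i).comap (koszulCycles x i).subtype

/-- The map `K(x^n) → K(x^m)`, `m ≤ n`, which is the tensor product over `j` of the maps
`K(x_j^n) → K(x_j^m)` that are the identity in degree `0` and multiplication by `x_j^(n-m)` in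
degree `1`. So `e_A ↦ (∏_{j ∈ A} x_j)^(n-m) e_A`; in top degree it is multiplication by
`(x_1 ⋯ x_l)^(n-m)`. -/
def koszulTransition (x : Fin l → R) (m n : ℕ) : KoszulChain R l →ₗ[R] KoszulChain R l where
  toFun c A := (∏ j ∈ A, x j) ^ (n - m) * c A
  map_add' a b := by
    funext A
    simp [mul_add]
  map_smul' r a := by
    funext A
    simp only [Pi.smul_apply, smul_eq_mul, RingHom.id_apply]
    ring

/-- The transition map is a map of complexes. -/
theorem koszulD_transition (x : Fin l → R) {m n : ℕ} (h : m ≤ n) (c : KoszulChain R l) :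
    koszulD (x ^ m) (koszulTransition x m n c) = koszulTransition x m n (koszulD (x ^ n) c) := by
  funext A
  simp only [koszulD, koszulTransition, LinearMap.coe_mk, AddHom.coe_mk, Finset.mul_sum]
  refine Finset.sum_congr rfl fun j hj => ?_
  rw [Finset.prod_insert (Finset.mem_compl.mp hj)]
  have e : (x ^ n) j = (x ^ m) j * x j ^ (n - m) := by
    simp only [Pi.pow_apply]
    rw [← pow_add, Nat.add_sub_cancel' h]
  rw [e]
  ring

theorem koszulTransition_degree (x : Fin l → R) (m n i : ℕ) {c : KoszulChain R l}
    (hc : c ∈ koszulDegree R l i) : koszulTransition x m n c ∈ koszulDegree R l i := by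
  intro A hA
  simp [koszulTransition, hc A hA]

theorem koszulTransition_cycles (x : Fin l → R) {m n : ℕ} (h : m ≤ n) (i : ℕ)
    (c : KoszulChain R l) (hc : c ∈ koszulCycles (x ^ n) i) :
    koszulTransition x m n c ∈ koszulCycles (x ^ m) i := by
  refine ⟨koszulTransition_degree x m n i hc.1, ?_⟩
  have h2 : koszulD (x ^ n) c = 0 := hc.2
  change koszulD (x ^ m) (koszulTransition x m n c) = 0
  rw [koszulD_transition x h, h2, map_zero]

/-- The map induced by the transition map on cycles. -/
def koszulCyclesMap (x : Fin l → R) {m n : ℕ} (h : m ≤ n) (i : ℕ) :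
    koszulCycles (x ^ n) i →ₗ[R] koszulCycles (x ^ m) i :=
  (koszulTransition x m n).restrict (koszulTransition_cycles x h i)

/-- The map `H_i(x^n; R) → H_i(x^m; R)` induced by the transition map. -/
def koszulHomologyMap (x : Fin l → R) {m n : ℕ} (h : m ≤ n) (i : ℕ) :
    KoszulHomology (x ^ n) i →ₗ[R] KoszulHomology (x ^ m) i :=
  Submodule.mapQ _ _ (koszulCyclesMap x h i) (by
    rintro ⟨c, hc⟩ hb
    obtain ⟨b, hb, hbc⟩ := hb
    refine ⟨koszulTransition x m n b, koszulTransition_degree x m n (i + 1) hb, ?_⟩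
    rw [koszulD_transition x h, hbc]
    rfl)

/-- `x` is weakly proregular: for each `m > 0` there is `n ≥ m` such that the maps
`H_i(x^n; R) → H_i(x^m; R)` are zero for all `i ≥ 1`. -/
def IsWeaklyProregular (x : Fin l → R) : Prop :=
  ∀ m : ℕ, 0 < m → ∃ (n : ℕ) (h : m ≤ n), ∀ i : ℕ, 1 ≤ i → koszulHomologyMap x h i = 0

end Koszul

section Cech

variable {R : Type u} [CommRing R] {l : ℕ}

/-- The underlying module of the Čech complex of `x`: the sum over all `A ⊆ {0, …, l-1}` of the
localizations of `R` at `∏_{j ∈ A} x_j`. -/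
abbrev CechCochain (x : Fin l → R) : Type u :=
  (A : Finset (Fin l)) → Localization.Away (∏ j ∈ A, x j)

/-- The cochains of degree `i`, the sum over the `A` with `#A = i`. -/
def cechDegree (x : Fin l → R) (i : ℕ) : Submodule R (CechCochain x) where
  carrier := {c | ∀ A : Finset (Fin l), A.card ≠ i → c A = 0}
  add_mem' := fun {a b} ha hb A hA => by simp [ha A hA, hb A hA]
  zero_mem' := fun A _ => rfl
  smul_mem' := fun r a ha A hA => by simp [ha A hA]

theorem isUnit_prod_of_subset (x : Fin l → R) {A B : Finset (Fin l)} (h : A ⊆ B) :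
    IsUnit (Algebra.ofId R (Localization.Away (∏ j ∈ B, x j)) (∏ j ∈ A, x j)) :=
  isUnit_of_dvd_unit (map_dvd _ (Finset.prod_dvd_prod_of_subset A B x h))
    (IsLocalization.Away.algebraMap_isUnit (∏ j ∈ B, x j))

/-- The natural map between localizations, for `A ⊆ B`. -/
noncomputable def cechRes (x : Fin l → R) {A B : Finset (Fin l)} (h : A ⊆ B) :
    Localization.Away (∏ j ∈ A, x j) →ₐ[R] Localization.Away (∏ j ∈ B, x j) :=
  IsLocalization.Away.liftAlgHom (∏ j ∈ A, x j) (f := Algebra.ofId R _)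
    (isUnit_prod_of_subset x h)

/-- The Čech differential: the natural maps from the components `B \ {j}` to the component `B`,
with the sign `(-1)^#{i ∈ B | i < j}`. -/
noncomputable def cechD (x : Fin l → R) : CechCochain x →ₗ[R] CechCochain x where
  toFun c B := ∑ j ∈ B, sign R B j • cechRes x (Finset.erase_subset j B) (c (B.erase j))
  map_add' a b := by
    funext B
    simp [Finset.sum_add_distrib]
  map_smul' r a := by
    funext B
    simp only [Pi.smul_apply, map_smul, RingHom.id_apply, Finset.smul_sum]
    exact Finset.sum_congr rfl fun j _ => smul_comm _ _ _

/-- The cocycles of degree `i`. -/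
noncomputable def cechCocycles (x : Fin l → R) (i : ℕ) : Submodule R (CechCochain x) :=
  cechDegree x i ⊓ LinearMap.ker (cechD x)

/-- The coboundaries of degree `i`: the image of the cochains of degree `i - 1`, and `0` for
`i = 0`. -/
noncomputable def cechCoboundaries (x : Fin l → R) : ℕ → Submodule R (CechCochain x)
  | 0 => ⊥
  | i + 1 => (cechDegree x i).map (cechD x)

/-- The Čech cohomology module `H^i_x(R)`. -/
abbrev CechCohomology (x : Fin l → R) (i : ℕ) : Type u :=
  cechCocycles x i ⧸ (cechCoboundaries x i).comap (cechCocycles x i).subtype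

end Cech

section HamiltonMarley

variable {R : Type u} [CommRing R] {l : ℕ}

/-- Parameter sequences: `(x)R ≠ R`, `x` is weakly proregular, and `H^l_x(R)_p ≠ 0` for every
prime ideal `p` that contains `(x)R`, where `l` is the length of `x`. -/
structure IsParameterSequence (x : Fin l → R) : Prop where
  span_ne_top : Ideal.span (Set.range x) ≠ ⊤
  weaklyProregular : IsWeaklyProregular x
  nontrivial_cech : ∀ (p : Ideal R) [p.IsPrime], Ideal.span (Set.range x) ≤ p →
    Nontrivial (LocalizedModule p.primeCompl (CechCohomology x l))

/-- Strong parameter sequences: `x_1, …, x_i` is a parameter sequence for all `1 ≤ i ≤ l`. -/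
def IsStrongParameterSequence (x : Fin l → R) : Prop :=
  ∀ (i : ℕ) (hi : i ≤ l), 1 ≤ i → IsParameterSequence (fun j : Fin i => x (Fin.castLE hi j))

/-- Cohen-Macaulay in the sense of Hamilton and Marley: every strong parameter sequence (of
positive length) is a regular sequence. -/
def IsHamiltonMarleyCohenMacaulay (R : Type u) [CommRing R] : Prop :=
  ∀ (l : ℕ) (x : Fin l → R), 1 ≤ l → IsStrongParameterSequence x →
    RingTheory.Sequence.IsRegular R (List.ofFn x)

end HamiltonMarley

/-- The depth of a Noetherian local ring: the supremum of the lengths of the regular sequences in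
the maximal ideal. -/
noncomputable def localDepth (R : Type u) [CommRing R] [IsLocalRing R] : ℕ∞ :=
  ⨆ rs : {rs : List R // RingTheory.Sequence.IsRegular R rs ∧
    ∀ r ∈ rs, r ∈ IsLocalRing.maximalIdeal R}, (rs.1.length : ℕ∞)

/-- Cohen-Macaulay rings in the usual sense: Noetherian rings such that depth equals dimension for
the localizations at all maximal ideals. -/
structure IsCohenMacaulayRing (R : Type u) [CommRing R] : Prop where
  isNoetherianRing : IsNoetherianRing R
  depth_eq_dim : ∀ (m : Ideal R) [m.IsMaximal],
    (localDepth (Localization.AtPrime m) : WithBot ℕ∞) = ringKrullDim (Localization.AtPrime m)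

/-- The amalgamated algebra `k + Q ⊆ S` of a `k`-algebra `S` along an ideal `Q`. -/
def amalgamated (k : Type u) {S : Type v} [Field k] [CommRing S] [Algebra k S] (Q : Ideal S) :
    Subalgebra k S where
  carrier := {s | ∃ (c : k) (q : S), q ∈ Q ∧ s = algebraMap k S c + q}
  add_mem' := by
    rintro _ _ ⟨c, q, hq, rfl⟩ ⟨c', q', hq', rfl⟩
    exact ⟨c + c', q + q', Q.add_mem hq hq', by rw [map_add]; ring⟩
  mul_mem' := by
    rintro _ _ ⟨c, q, hq, rfl⟩ ⟨c', q', hq', rfl⟩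
    refine ⟨c * c', algebraMap k S c * q' + (algebraMap k S c' + q') * q,
      Q.add_mem (Q.mul_mem_left _ hq') (Q.mul_mem_left _ hq), ?_⟩
    rw [map_mul]
    ring
  algebraMap_mem' := fun c => ⟨c, 0, Q.zero_mem, by simp⟩

end CohenMacaulay

namespace CohenMacaulay

/-! Write R = k + fS. Depth at least two and height at least three at 𝔪 allow a choice of an
S-regular pair a, b in 𝔪 together with a prime Q ⊆ 𝔪 of S that contains a and b but not f
(`exists_regular_pair_and_prime`). The sequence fa, fb in R is then a strong parameter sequence that
is not regular.

It is not regular because (fb)(fas) = (fa)(fbs) for every s in S, whereas fas lies in faR only if s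
is in R, and R ≠ S.

It is weakly proregular because a relation between powers of fa and fb is trivial over S, and the
transition maps multiply by enough powers of f to bring its coefficient into fS ⊆ R
(`isWeaklyProregular_mulAmalgamated_pair`).

For the Čech condition at a prime p of R containing fa and fb, it is enough to have a prime P of S
that contains a and b, avoids f, and satisfies P ∩ R ⊆ p
(`isParameterSequence_mulAmalgamated_pair`). If fS is not contained in p, then p itself comes from
such a P (`exists_prime_avoiding_of_notMem`). If fS ⊆ p, then Q serves, since Q ∩ R ⊆ 𝔪 ∩ R = fS. -/

/-! ### Choosing the regular pair and the prime Q in S. -/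

/-- Prime avoidance: an ideal contained in no member of a finite set of primes has an element
outside all of them. -/
theorem exists_mem_forall_notMem_of_finite {S : Type v} [CommRing S] {I : Ideal S}
    {T : Set (Ideal S)} (hT : T.Finite) (hprime : ∀ p ∈ T, p.IsPrime) (hI : ∀ p ∈ T, ¬ I ≤ p) :
    ∃ a ∈ I, ∀ p ∈ T, a ∉ p := by
  by_contra! h
  have hsub : (I : Set S) ⊆ ⋃ p ∈ (↑hT.toFinset : Set (Ideal S)), (id p : Ideal S) := by
    intro a ha
    obtain ⟨p, hp, hap⟩ := h a ha
    simp only [Set.mem_iUnion]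
    exact ⟨p, by simpa using hp, hap⟩
  obtain ⟨p, hp, hle⟩ := (Ideal.subset_union_prime (f := id) ⊥ ⊥
    (fun p hp _ _ => hprime p (by simpa using hp))).mp hsub
  exact hI p (by simpa using hp) hle

/-- A local ring of depth at least two has a regular sequence of length two in its maximal
ideal. -/
theorem exists_regular_pair_of_two_le_localDepth {A : Type v} [CommRing A] [IsLocalRing A]
    (h : 2 ≤ localDepth A) :
    ∃ r₁ ∈ IsLocalRing.maximalIdeal A, ∃ r₂ ∈ IsLocalRing.maximalIdeal A,
      (∀ x y, r₁ * x = r₁ * y → x = y) ∧ ∀ x, r₁ ∣ r₂ * x → r₁ ∣ x := by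
  by_contra! hcon
  have hle : localDepth A ≤ 1 := by
    refine iSup_le ?_
    rintro ⟨rs, hrs, hmem⟩
    match rs, hrs, hmem with
    | [], _, _ => simp
    | [_], _, _ => simp
    | r₁ :: r₂ :: rs, hrs, hmem =>
      exfalso
      rw [RingTheory.Sequence.isRegular_cons_iff, RingTheory.Sequence.isRegular_cons_iff] at hrs
      obtain ⟨h₁, h₂, -⟩ := hrs
      obtain ⟨x, hx, hx'⟩ := hcon r₁ (hmem _ (by simp)) r₂ (hmem _ (by simp))
        (fun x y hxy => h₁ hxy)
      refine hx' ?_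
      have := (isSMulRegular_quotient_iff_mem_of_smul_mem _ _).mp h₂ x (by
        obtain ⟨y, hy⟩ := hx
        exact ⟨y, trivial, by simpa using hy.symm⟩)
      obtain ⟨y, -, hy⟩ := this
      exact ⟨y, by simpa using hy.symm⟩
  have := h.trans hle
  norm_num at this

/-- In a domain, if the localization at a maximal ideal has depth at least two, then that maximal
ideal is not associated to a nonzero principal ideal. -/
theorem not_isAssociatedPrime_quotient_span_singleton {S : Type v} [CommRing S] [IsDomain S]
    [IsNoetherianRing S] (𝔪 : Ideal S) [𝔪.IsMaximal]
    (h : 2 ≤ localDepth (Localization.AtPrime 𝔪)) {a : S} (ha : a ≠ 0) :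
    ¬ IsAssociatedPrime 𝔪 (S ⧸ Ideal.span {a}) := by
  intro hass
  rw [isAssociatedPrime_iff] at hass
  obtain ⟨-, x, hx⟩ := hass
  obtain ⟨c, rfl⟩ := Ideal.Quotient.mk_surjective x
  have hmem : ∀ t, t ∈ 𝔪 ↔ a ∣ t * c := by
    intro t
    rw [hx, Submodule.mem_colon_singleton, Submodule.mem_bot, ← Ideal.mem_span_singleton,
      ← Ideal.Quotient.eq_zero_iff_mem, map_mul]
    rfl
  set A := Localization.AtPrime 𝔪
  have hinj : Function.Injective (algebraMap S A) :=
    IsLocalization.injective A 𝔪.primeCompl_le_nonZeroDivisors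
  have : IsDomain A := IsLocalization.isDomain_localization 𝔪.primeCompl_le_nonZeroDivisors
  have haA : algebraMap S A a ≠ 0 := by simpa using hinj.ne ha
  obtain ⟨r₁, hr₁, r₂, hr₂, h₁, h₂⟩ := exists_regular_pair_of_two_le_localDepth h
  have hdvd : ∀ r ∈ IsLocalRing.maximalIdeal A, algebraMap S A a ∣ r * algebraMap S A c := by
    intro r hr
    rw [← Localization.AtPrime.map_eq_maximalIdeal] at hr
    induction hr using Submodule.span_induction with
    | mem _ hr =>
      obtain ⟨t, ht, rfl⟩ := hr
      rw [← map_mul]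
      exact map_dvd _ ((hmem t).mp ht)
    | zero => simp
    | add _ _ _ _ hu hv => rw [add_mul]; exact dvd_add hu hv
    | smul s _ _ hu => rw [smul_eq_mul, mul_assoc]; exact hu.mul_left s
  obtain ⟨u, hu⟩ := hdvd r₁ hr₁
  obtain ⟨v, hv⟩ := hdvd r₂ hr₂
  -- Both r₁c = au and r₂c = av hold, so regularity of r₁, r₂ forces r₁ to divide u, and then a
  -- divides c locally.
  have huv : r₂ * u = r₁ * v := by
    apply mul_left_cancel₀ haA
    linear_combination r₁ * hv - r₂ * hu
  obtain ⟨w, rfl⟩ := h₂ u ⟨v, huv⟩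
  have hc : algebraMap S A c = algebraMap S A a * w := h₁ _ _ (by rw [hu]; ring)
  -- Clearing the denominator t of w gives a ∣ tc, which puts t in 𝔪.
  obtain ⟨⟨w', t⟩, hw⟩ := IsLocalization.surj 𝔪.primeCompl w
  refine t.2 ((hmem t).mpr ⟨w', hinj ?_⟩)
  simp only at hw
  rw [map_mul, map_mul, hc, ← hw]
  ring

/-- If `S_𝔪` has depth at least two and dimension at least three, and `f ≠ 0` lies in `𝔪`, then `𝔪`
contains an `S`-regular pair `a, b` and a prime over `(a, b)` which avoids `f`. -/
theorem exists_regular_pair_and_prime {S : Type v} [CommRing S] [IsDomain S]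
    [IsNoetherianRing S] (𝔪 : Ideal S) [𝔪.IsMaximal]
    (hdepth : 2 ≤ localDepth (Localization.AtPrime 𝔪)) (hheight : 3 ≤ 𝔪.height)
    {f : S} (hf : f ≠ 0) (hfm : f ∈ 𝔪) :
    ∃ a b : S, a ≠ 0 ∧ (∀ x, a ∣ b * x → a ∣ x) ∧
      ∃ Q : Ideal S, Q.IsPrime ∧ Q ≤ 𝔪 ∧ a ∈ Q ∧ b ∈ Q ∧ f ∉ Q := by
  have hlt : ∀ p : Ideal S, p.height ≤ 2 → ¬ 𝔪 ≤ p := fun p hp hle => by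
    have := hheight.trans ((Ideal.height_mono hle).trans hp)
    norm_num at this
  have hcard : ∀ x y : S, ∀ p ∈ (Ideal.span {x, y}).minimalPrimes, p.height ≤ 2 := by
    intro x y p hp
    refine (Ideal.height_le_card_of_mem_minimalPrimes_span (Set.toFinite {x, y}) hp).trans ?_
    exact_mod_cast (Set.ncard_insert_le x {y}).trans (by simp)
  -- The ideal (f) is written as the span of f, f so that the height bound `hcard` for pairs applies
  -- to it.
  obtain ⟨a, ham, ha⟩ := exists_mem_forall_notMem_of_finite
    (Ideal.finite_minimalPrimes_of_isNoetherianRing S (Ideal.span {f, f}))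
    (fun p hp => hp.1.1) (fun p hp => hlt p (hcard _ _ p hp)) (I := 𝔪)
  have ha0 : a ≠ 0 := by
    rintro rfl
    have hle : Ideal.span {f, f} ≤ 𝔪 := by
      rw [Ideal.span_le]
      rintro _ (rfl | rfl) <;> exact hfm
    obtain ⟨p, hp, -⟩ := Ideal.exists_minimalPrimes_le hle
    exact ha p hp p.zero_mem
  -- Avoiding the associated primes of S/(a) makes a, b regular; avoiding the minimal primes of (f,
  -- a) keeps f out of Q.
  obtain ⟨b, hbm, hb⟩ := exists_mem_forall_notMem_of_finite (I := 𝔪)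
    (T := (Ideal.span {f, a}).minimalPrimes ∪ associatedPrimes S (S ⧸ Ideal.span {a}))
    ((Ideal.finite_minimalPrimes_of_isNoetherianRing S _).union (associatedPrimes.finite S _))
    (by
      rintro p (hp | hp)
      · exact hp.1.1
      · exact hp.isPrime)
    (by
      rintro p (hp | hp)
      · exact hlt p (hcard _ _ p hp)
      · intro hle
        have : 𝔪 = p := Ideal.IsMaximal.eq_of_le inferInstance hp.isPrime.ne_top hle
        subst this
        exact not_isAssociatedPrime_quotient_span_singleton 𝔪 hdepth ha0 hp)
  refine ⟨a, b, ha0, ?_, ?_⟩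
  · intro x hx
    by_contra hax
    have hx0 : Ideal.Quotient.mk (Ideal.span {a}) x ≠ 0 := by
      rwa [Ne, Ideal.Quotient.eq_zero_iff_mem, Ideal.mem_span_singleton]
    have : b ∈ ⋃ p ∈ associatedPrimes S (S ⧸ Ideal.span {a}), (p : Set S) := by
      rw [biUnion_associatedPrimes_eq_zero_divisors]
      refine ⟨_, hx0, ?_⟩
      rw [Algebra.smul_def, Ideal.Quotient.algebraMap_eq, ← map_mul,
        Ideal.Quotient.eq_zero_iff_mem, Ideal.mem_span_singleton]
      exact hx
    simp only [Set.mem_iUnion] at this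
    obtain ⟨p, hp, hbp⟩ := this
    exact hb p (Or.inr hp) hbp
  · have hle : Ideal.span {a, b} ≤ 𝔪 := by
      rw [Ideal.span_le]
      rintro _ (rfl | rfl) <;> assumption
    obtain ⟨Q, hQ, hQm⟩ := Ideal.exists_minimalPrimes_le hle
    have : Q.IsPrime := hQ.1.1
    have haQ : a ∈ Q := hQ.1.2 (Ideal.subset_span (by simp))
    have hbQ : b ∈ Q := hQ.1.2 (Ideal.subset_span (by simp))
    refine ⟨Q, hQ.1.1, hQm, haQ, hbQ, fun hfQ => ?_⟩
    -- If f were in Q, the chain 0 < P₁ < P₂ < Q would give Q height at least three, although Q is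
    -- minimal over two elements.
    have hle₂ : Ideal.span {f, a} ≤ Q := by
      rw [Ideal.span_le]
      rintro _ (rfl | rfl) <;> assumption
    obtain ⟨P₂, hP₂, hP₂Q⟩ := Ideal.exists_minimalPrimes_le hle₂
    have : P₂.IsPrime := hP₂.1.1
    have hle₁ : Ideal.span {f, f} ≤ P₂ := by
      rw [Ideal.span_le]
      rintro _ (rfl | rfl) <;> exact hP₂.1.2 (Ideal.subset_span (by simp))
    obtain ⟨P₁, hP₁, hP₁P₂⟩ := Ideal.exists_minimalPrimes_le hle₁
    have : P₁.IsPrime := hP₁.1.1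
    have h₂ : P₂ < Q := lt_of_le_of_ne hP₂Q (by
      rintro rfl
      exact hb P₂ (Or.inl hP₂) hbQ)
    have h₁ : P₁ < P₂ := lt_of_le_of_ne hP₁P₂ (by
      rintro rfl
      exact ha P₁ hP₁ (hP₂.1.2 (Ideal.subset_span (by simp))))
    have h₀ : (⊥ : Ideal S) < P₁ := bot_lt_iff_ne_bot.mpr (by
      rintro rfl
      exact hf (hP₁.1.2 (Ideal.subset_span (by simp))))
    have e₂ := Ideal.height_add_one_le_of_lt_of_isPrime h₂
    have e₁ := Ideal.height_add_one_le_of_lt_of_isPrime h₁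
    have e₀ := Ideal.height_add_one_le_of_lt_of_isPrime h₀
    rw [Ideal.height_bot, zero_add] at e₀
    have : (1 + 1 + 1 : ℕ∞) ≤ 2 :=
      ((add_le_add_left ((add_le_add_left e₀ 1).trans e₁) 1).trans e₂).trans (hcard _ _ Q hQ)
    norm_num at this

/-! ### Nonvanishing of top Čech cohomology. -/

/-- If no element `s ∉ p` satisfies `s (x_1 ⋯ x_l)^N ∈ (x_1^(N+1), …, x_l^(N+1))`, then the top Čech
cohomology of `x` does not vanish at `p`. -/
theorem nontrivial_localizedModule_cechCohomology {R : Type u} [CommRing R] {l : ℕ}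
    (x : Fin (l + 1) → R) (p : Ideal R) [p.IsPrime]
    (h : ∀ s ∉ p, ∀ N : ℕ,
      s * (∏ j, x j) ^ N ∉ Ideal.span (Set.range fun j => x j ^ (N + 1))) :
    Nontrivial (LocalizedModule p.primeCompl (CechCohomology x (l + 1))) := by
  set π := ∏ j, x j with hπ
  let L := Localization.Away π
  -- The class that survives at p is that of 1/π.
  let e : CechCochain x := Pi.single (M := fun A => Localization.Away (∏ j ∈ A, x j))
    Finset.univ (IsLocalization.Away.invSelf π)
  have he : e ∈ cechCocycles x (l + 1) := by
    refine ⟨fun A hA => ?_, ?_⟩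
    · exact Pi.single_eq_of_ne (by rintro rfl; simp at hA) _
    · change cechD x e = 0
      funext B
      refine Finset.sum_eq_zero fun j hj => ?_
      have : e (B.erase j) = 0 := Pi.single_eq_of_ne (fun hB => by
        have := Finset.mem_univ j
        rw [← hB] at this
        simp at this) _
      rw [this, map_zero, smul_zero]
  refine ⟨⟨LocalizedModule.mk
    (Submodule.Quotient.mk (⟨e, he⟩ : cechCocycles x (l + 1)) : CechCohomology x (l + 1)) 1, 0, fun h0 => ?_⟩⟩
  rw [← LocalizedModule.zero_mk 1, LocalizedModule.mk_eq] at h0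
  obtain ⟨⟨s, hs⟩, h0⟩ := h0
  simp only [one_smul, smul_zero] at h0
  change s • (Submodule.Quotient.mk (⟨e, he⟩ : cechCocycles x (l + 1)) :
    CechCohomology x (l + 1)) = 0 at h0
  rw [← Submodule.Quotient.mk_smul, Submodule.Quotient.mk_eq_zero] at h0
  obtain ⟨c, -, hc⟩ := h0
  have hfac : ∀ j, π = x j * ∏ i ∈ Finset.univ.erase j, x i := fun j =>
    (Finset.mul_prod_erase _ _ (Finset.mem_univ j)).symm
  obtain ⟨z, hsum, hz⟩ : ∃ z : Fin (l + 1) → L,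
      s • IsLocalization.Away.invSelf (S := L) π = ∑ j, sign R Finset.univ j • z j ∧
      ∀ j, ∃ n u, z j * algebraMap R L (∏ i ∈ Finset.univ.erase j, x i) ^ n =
        algebraMap R L u := by
    refine ⟨fun j => cechRes x (Finset.erase_subset j Finset.univ) (c (Finset.univ.erase j)),
      ?_, fun j => ?_⟩
    · have heu : e Finset.univ = IsLocalization.Away.invSelf (S := L) π :=
        Pi.single_eq_same (M := fun A => Localization.Away (∏ j ∈ A, x j)) _ _
      rw [← heu]
      exact (congrFun hc Finset.univ).symm
    · obtain ⟨n, u, hu⟩ := IsLocalization.Away.surj (∏ i ∈ Finset.univ.erase j, x i)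
        (c (Finset.univ.erase j))
      refine ⟨n, u, ?_⟩
      have := congrArg (cechRes x (Finset.erase_subset j Finset.univ)) hu
      rwa [map_mul, map_pow, AlgHom.commutes, AlgHom.commutes] at this
  choose n u hu using hz
  set N := Finset.univ.sup n
  have hN : ∀ j, algebraMap R L π ^ N * z j =
      algebraMap R L (x j ^ N * ((∏ i ∈ Finset.univ.erase j, x i) ^ (N - n j) * u j)) := by
    intro j
    have hle : n j ≤ N := Finset.le_sup (Finset.mem_univ j)
    obtain ⟨d, hd⟩ := Nat.exists_eq_add_of_le' hle
    have hπj : algebraMap R L π =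
        algebraMap R L (x j) * algebraMap R L (∏ i ∈ Finset.univ.erase j, x i) := by
      rw [← map_mul]
      exact congrArg _ (hfac j)
    rw [hd, Nat.add_sub_cancel, map_mul, map_mul, map_pow, map_pow, ← hu, hπj]
    ring
  have hinv : algebraMap R L π * IsLocalization.Away.invSelf (S := L) π = 1 :=
    IsLocalization.Away.mul_invSelf π
  set w := fun j => sign R Finset.univ j *
    (x j ^ N * ((∏ i ∈ Finset.univ.erase j, x i) ^ (N - n j) * u j)) with hw
  have heq : algebraMap R L (s * π ^ N) = algebraMap R L (∑ j, π * w j) := by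
    calc algebraMap R L (s * π ^ N)
        = algebraMap R L π * (algebraMap R L π ^ N *
            (s • IsLocalization.Away.invSelf (S := L) π)) := by
          rw [map_mul, map_pow, Algebra.smul_def]
          linear_combination (-(algebraMap R L s * algebraMap R L π ^ N)) * hinv
      _ = ∑ j, algebraMap R L (π * w j) := by
          rw [hsum, Finset.mul_sum, Finset.mul_sum]
          refine Finset.sum_congr rfl fun j _ => ?_
          rw [map_mul, hw, map_mul, ← hN j, Algebra.smul_def]
          ring
      _ = algebraMap R L (∑ j, π * w j) := (map_sum _ _ _).symm
  obtain ⟨M, hM⟩ := IsLocalization.Away.exists_of_eq π heq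
  -- Each `w j` carries x_j^N, the factor π supplies one more x_j and π^M supplies M more: M + N + 1
  -- in all.
  refine h s hs (M + N) ?_
  have : s * π ^ (M + N) = ∑ j, π ^ M * (π * w j) := by
    rw [← Finset.mul_sum, ← hM]
    ring
  rw [this]
  refine Ideal.sum_mem _ fun j _ => ?_
  obtain ⟨t, ht⟩ : x j ∣ π := Finset.dvd_prod_of_mem _ (Finset.mem_univ j)
  have : π ^ M * (π * w j) = (t ^ M * t * sign R Finset.univ j *
      ((∏ i ∈ Finset.univ.erase j, x i) ^ (N - n j) * u j)) * x j ^ (M + N + 1) := by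
    rw [hw, ht]
    ring
  rw [this]
  exact Ideal.mul_mem_left _ _ (Ideal.subset_span ⟨j, rfl⟩)

/-! ### Weak proregularity for sequences of length one and two. -/

/-- A criterion for weak proregularity in terms of cycles and boundaries. -/
theorem isWeaklyProregular_of_forall {R : Type u} [CommRing R] {l : ℕ} (x : Fin l → R)
    (h : ∀ m : ℕ, 0 < m → ∃ n, m ≤ n ∧ ∀ i, 1 ≤ i → ∀ c ∈ koszulCycles (x ^ n) i,
      koszulTransition x m n c ∈ koszulBoundaries (x ^ m) i) :
    IsWeaklyProregular x := by
  intro m hm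
  obtain ⟨n, hmn, H⟩ := h m hm
  refine ⟨n, hmn, fun i hi => ?_⟩
  ext ⟨c, hc⟩
  change Submodule.Quotient.mk (koszulCyclesMap x hmn i ⟨c, hc⟩) = 0
  rw [Submodule.Quotient.mk_eq_zero]
  exact H i hi c hc

/-- A sequence consisting of one nonzero element of a domain is weakly proregular. -/
theorem isWeaklyProregular_of_domain_one {R : Type u} [CommRing R] [IsDomain R] (x : Fin 1 → R)
    (hx : x 0 ≠ 0) : IsWeaklyProregular x := by
  refine isWeaklyProregular_of_forall x fun m _ => ⟨m, le_rfl, fun i hi c hc => ?_⟩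
  have h0 : c = 0 := by
    funext A
    by_cases hA : A.card = i
    · have hAu : A = {0} := by
        have hsub : ∀ A : Finset (Fin 1), A = ∅ ∨ A = {0} := by decide
        refine (hsub A).resolve_left ?_
        rintro rfl
        simp at hA
        omega
      have := congrFun (show koszulD (x ^ m) c = 0 from hc.2) ∅
      simp [koszulD, sign, hx] at this
      rw [hAu]
      exact this
    · exact hc.1 A hA
  rw [h0, map_zero]
  exact Submodule.zero_mem _

/-- A pair in a domain is weakly proregular if, after the transition maps, its relations become
trivial. -/
theorem isWeaklyProregular_of_domain_two {R : Type u} [CommRing R] [IsDomain R] (x : Fin 2 → R)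
    (hx : x 1 ≠ 0)
    (h : ∀ m : ℕ, ∃ n, m ≤ n ∧ ∀ u v : R, x 0 ^ n * u + x 1 ^ n * v = 0 →
      ∃ r, x 0 ^ (n - m) * u = -(x 1 ^ m * r) ∧ x 1 ^ (n - m) * v = x 0 ^ m * r) :
    IsWeaklyProregular x := by
  refine isWeaklyProregular_of_forall x fun m _ => ?_
  obtain ⟨n, hmn, H⟩ := h m
  refine ⟨n, hmn, fun i hi c hc => ?_⟩
  have hD : koszulD (x ^ n) c = 0 := hc.2
  have hdeg : ∀ A : Finset (Fin 2), A.card ≠ i → c A = 0 := hc.1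
  have hcompl₀ : ({0} : Finset (Fin 2))ᶜ = {1} := by decide
  have hcompl₁ : ({1} : Finset (Fin 2))ᶜ = {0} := by decide
  have hins₀ : (insert 1 {0} : Finset (Fin 2)) = Finset.univ := by decide
  have hins₁ : (insert 0 {1} : Finset (Fin 2)) = Finset.univ := by decide
  have hsign₀ : sign R ({0} : Finset (Fin 2)) 1 = -1 := by
    have : ({0} : Finset (Fin 2)).filter (fun i => i < 1) = {0} := by decide
    rw [sign, this]
    simp
  have hsign₁ : sign R ({1} : Finset (Fin 2)) 0 = 1 := by
    have : ({1} : Finset (Fin 2)).filter (fun i => i < 0) = ∅ := by decide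
    rw [sign, this]
    simp
  have hsub : ∀ A : Finset (Fin 2), A = ∅ ∨ A = {0} ∨ A = {1} ∨ A = Finset.univ := by decide
  -- In a domain a nonzero x₁ kills no nonzero top chain, so only degree one carries homology.
  have htop : i ≠ 1 → c = 0 := by
    intro hi1
    have h₂ : c Finset.univ = 0 := by
      have := congrFun hD {0}
      simpa [koszulD, hcompl₀, hins₀, hsign₀, hx] using this
    funext A
    rcases hsub A with rfl | rfl | rfl | rfl
    · exact hdeg _ (by simp; omega)
    · exact hdeg _ (by simp; omega)
    · exact hdeg _ (by simp; omega)
    · exact h₂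
  by_cases hi1 : i = 1
  · subst hi1
    have hrel : x 0 ^ n * c {0} + x 1 ^ n * c {1} = 0 := by
      have := congrFun hD ∅
      simpa [koszulD, sign, Fin.sum_univ_two] using this
    obtain ⟨r, hr₀, hr₁⟩ := H _ _ hrel
    refine ⟨Pi.single Finset.univ r, fun A hA => Pi.single_eq_of_ne ?_ _, ?_⟩
    · rintro rfl
      simp at hA
    · funext A
      rcases hsub A with rfl | rfl | rfl | rfl
      · simp [koszulD, koszulTransition, hdeg ∅ (by simp)]
      · simp [koszulD, koszulTransition, hcompl₀, hins₀, hsign₀, hr₀]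
      · simp [koszulD, koszulTransition, hcompl₁, hins₁, hsign₁, hr₁]
      · simp [koszulD, koszulTransition, hdeg Finset.univ (by simp)]
  · rw [htop hi1, map_zero]
    exact Submodule.zero_mem _

/-! ### Powers of a regular pair in a domain. -/

section RegularPair

variable {S : Type v} [CommRing S] {a b : S}

theorem dvd_of_dvd_pow_mul (h : ∀ x, a ∣ b * x → a ∣ x) (n : ℕ) {x : S} (hx : a ∣ b ^ n * x) :
    a ∣ x := by
  induction n with
  | zero => simpa using hx
  | succ n ih => exact ih (h _ (by rwa [← mul_assoc, ← pow_succ']))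

/-- Regularity modulo a passes to powers of a by splitting off and cancelling one factor a at a
time. -/
theorem pow_dvd_of_pow_dvd_pow_mul [IsDomain S] (ha : a ≠ 0) (h : ∀ x, a ∣ b * x → a ∣ x) (m n : ℕ) {x : S}
    (hx : a ^ m ∣ b ^ n * x) : a ^ m ∣ x := by
  induction m generalizing x with
  | zero => simp
  | succ m ih =>
    obtain ⟨y, rfl⟩ := dvd_of_dvd_pow_mul h n (dvd_trans (dvd_pow_self a m.succ_ne_zero) hx)
    rw [pow_succ'] at hx ⊢
    refine mul_dvd_mul_left a (ih ((mul_dvd_mul_iff_left ha).mp ?_))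
    rwa [mul_left_comm] at hx

/-- For a regular pair `a, b`, the colon ideal `(a^(N+1), b^(N+1)) : (a b)^N` is `(a, b)`. -/
theorem exists_eq_of_mul_pow_eq [IsDomain S] (ha : a ≠ 0) (h : ∀ x, a ∣ b * x → a ∣ x) (N : ℕ)
    {t u v : S} (ht : t * (a * b) ^ N = a ^ (N + 1) * u + b ^ (N + 1) * v) :
    ∃ y z, t = a * y + b * z := by
  obtain ⟨v', rfl⟩ : a ^ N ∣ v := pow_dvd_of_pow_dvd_pow_mul ha h N (N + 1)
    ⟨t * b ^ N - a * u, by rw [mul_pow] at ht; linear_combination -ht⟩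
  have h1 : t * b ^ N = a * u + b ^ (N + 1) * v' := by
    apply mul_left_cancel₀ (pow_ne_zero N ha)
    rw [mul_pow] at ht
    linear_combination ht
  obtain ⟨y, hy⟩ := dvd_of_dvd_pow_mul h N (x := t - b * v') ⟨u, by linear_combination h1⟩
  exact ⟨y, v', by linear_combination hy⟩

end RegularPair

/-! ### Primes and elements of k + fS. -/

section Amalgamated

variable (k : Type u) {S : Type v} [Field k] [CommRing S] [Algebra k S]

/-- The element `f s` of the subring `k + f S` of `S`. -/
def mulAmalgamated (f s : S) : amalgamated k (Ideal.span {f}) :=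
  ⟨f * s, 0, f * s, Ideal.mem_span_singleton.mpr (dvd_mul_right f s), by simp⟩

@[simp]
theorem coe_mulAmalgamated (f s : S) : (mulAmalgamated k f s : S) = f * s := rfl

variable {k}

/-- A prime of `k + f S` not containing `f S` is the contraction of a prime of `S` which avoids
`f`. -/
theorem exists_prime_avoiding_of_notMem {f t : S} (p : Ideal (amalgamated k (Ideal.span {f})))
    [p.IsPrime] (ht : mulAmalgamated k f t ∉ p) :
    ∃ P : Ideal S, P.IsPrime ∧ f ∉ P ∧ (∀ s, mulAmalgamated k f s ∈ p → s ∈ P) ∧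
      ∀ r : amalgamated k (Ideal.span {f}), (r : S) ∈ P → r ∈ p := by
  have hp : p.IsPrime := inferInstance
  -- Inverting ft identifies k + fS with S, so P consists of the s whose multiple fts lies in p.
  let P : Ideal S :=
    { carrier := {s | mulAmalgamated k f (t * s) ∈ p}
      add_mem' := fun {x y} hx hy => by
        have : mulAmalgamated k f (t * (x + y)) =
            mulAmalgamated k f (t * x) + mulAmalgamated k f (t * y) :=
          Subtype.ext (by simp [mul_add])
        rw [Set.mem_ofPred_eq, this]
        exact p.add_mem hx hy
      zero_mem' := by
        have : mulAmalgamated k f (t * 0) = 0 := Subtype.ext (by simp)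
        rw [Set.mem_ofPred_eq, this]
        exact p.zero_mem
      smul_mem' := fun c x hx => by
        have : mulAmalgamated k f (t * (c * x)) * mulAmalgamated k f t =
            mulAmalgamated k f (t * x) * mulAmalgamated k f (t * c) :=
          Subtype.ext (by simp; ring)
        refine (hp.mem_or_mem (?_ : mulAmalgamated k f (t * (c * x)) * mulAmalgamated k f t ∈ p)
          ).resolve_right ht
        rw [this]
        exact p.mul_mem_right _ hx }
  have hmem : ∀ s, s ∈ P ↔ mulAmalgamated k f (t * s) ∈ p := fun s => Iff.rfl
  refine ⟨P, ⟨?_, ?_⟩, ?_, ?_, ?_⟩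
  · rw [Ideal.ne_top_iff_one, hmem, mul_one]
    exact ht
  · intro x y hxy
    rw [hmem] at hxy
    refine hp.mem_or_mem ?_
    have : mulAmalgamated k f (t * x) * mulAmalgamated k f (t * y) =
        mulAmalgamated k f (t * (x * y)) * mulAmalgamated k f t :=
      Subtype.ext (by simp; ring)
    rw [this]
    exact p.mul_mem_right _ hxy
  · rw [hmem]
    intro hft
    have : mulAmalgamated k f t ^ 3 =
        mulAmalgamated k f (t * f) * mulAmalgamated k f (t * t) :=
      Subtype.ext (by simp; ring)
    refine ht (hp.mem_of_pow_mem 3 ?_)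
    rw [this]
    exact p.mul_mem_right _ hft
  · intro s hs
    rw [hmem]
    have : mulAmalgamated k f (t * s) * mulAmalgamated k f t =
        mulAmalgamated k f s * mulAmalgamated k f (t * t) :=
      Subtype.ext (by simp; ring)
    refine (hp.mem_or_mem (?_ : mulAmalgamated k f (t * s) * mulAmalgamated k f t ∈ p)
      ).resolve_right ht
    rw [this]
    exact p.mul_mem_right _ hs
  · intro r hr
    rw [hmem] at hr
    have : mulAmalgamated k f t * r = mulAmalgamated k f (t * r) :=
      Subtype.ext (by simp [mul_assoc])
    rw [← this] at hr
    exact (hp.mem_or_mem hr).resolve_left ht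

/-- If `f` lies in a proper ideal `𝔪` of `S`, then `𝔪 ∩ (k + f S) = f S`. -/
theorem exists_eq_mulAmalgamated_of_mem {f : S} {𝔪 : Ideal S} (h𝔪 : 𝔪 ≠ ⊤) (hf : f ∈ 𝔪)
    (r : amalgamated k (Ideal.span {f})) (hr : (r : S) ∈ 𝔪) : ∃ s, r = mulAmalgamated k f s := by
  obtain ⟨r, c, q, hq, rfl⟩ := r
  obtain ⟨s, rfl⟩ := Ideal.mem_span_singleton.mp hq
  have hc : c = 0 := by
    by_contra hc
    have : algebraMap k S c ∈ 𝔪 := by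
      have := 𝔪.sub_mem hr (𝔪.mul_mem_right s hf)
      simpa using this
    exact h𝔪 (Ideal.eq_top_of_isUnit_mem _ this ((IsUnit.mk0 c hc).map (algebraMap k S)))
  exact ⟨s, Subtype.ext (by simp [hc])⟩

/-- If a proper ideal of `S` contains `f` and is not generated by it, then `k + f S ≠ S`. -/
theorem exists_notMem_amalgamated {f : S} {𝔪 : Ideal S} (h𝔪 : 𝔪 ≠ ⊤) (hf : f ∈ 𝔪)
    (hne : ¬ 𝔪 ≤ Ideal.span {f}) : ∃ s : S, s ∉ amalgamated k (Ideal.span {f}) := by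
  obtain ⟨s, hs, hsf⟩ := SetLike.not_le_iff_exists.mp hne
  refine ⟨s, fun h => hsf ?_⟩
  obtain ⟨t, ht⟩ := exists_eq_mulAmalgamated_of_mem (k := k) h𝔪 hf ⟨s, h⟩ hs
  rw [Ideal.mem_span_singleton]
  exact ⟨t, congrArg Subtype.val ht⟩

end Amalgamated

/-! ### The sequence fa, fb in k + fS. -/

section Domain

variable {k : Type u} {S : Type v} [Field k] [CommRing S] [IsDomain S] [Algebra k S] {f a b : S}

theorem isParameterSequence_of_domain_one {R : Type u} [CommRing R] [IsDomain R] (x : Fin 1 → R)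
    (hx : x 0 ≠ 0) (hspan : Ideal.span (Set.range x) ≠ ⊤) : IsParameterSequence x where
  span_ne_top := hspan
  weaklyProregular := isWeaklyProregular_of_domain_one x hx
  nontrivial_cech p _ hp := by
    refine nontrivial_localizedModule_cechCohomology x p fun s hs N hmem => hs ?_
    have hr : Set.range (fun j => x j ^ (N + 1)) = {x 0 ^ (N + 1)} := by
      rw [Set.range_unique]
      rfl
    rw [hr, Ideal.mem_span_singleton] at hmem
    obtain ⟨u, hu⟩ := hmem
    have : s = x 0 * u := by
      apply mul_left_cancel₀ (pow_ne_zero N hx)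
      have hprod : ∏ j : Fin (0 + 1), x j = x 0 := Fin.prod_univ_one x
      rw [hprod] at hu
      linear_combination hu
    rw [this]
    exact p.mul_mem_right _ (hp (Ideal.subset_span ⟨0, rfl⟩))

/-- Over S a relation has the form u = -bⁿw, v = aⁿw with w in S. The transition map contributes
f^(n-m), of which f^m is absorbed by the m-th powers; n = 2m + 1 leaves one factor f, so the new
coefficient lies in fS. -/
theorem isWeaklyProregular_mulAmalgamated_pair (hf : f ≠ 0) (ha : a ≠ 0) (hb : b ≠ 0)
    (hab : ∀ x, a ∣ b * x → a ∣ x) :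
    IsWeaklyProregular ![mulAmalgamated k f a, mulAmalgamated k f b] := by
  refine isWeaklyProregular_of_domain_two _ ?_ fun m => ⟨2 * m + 1, by omega, fun u v huv => ?_⟩
  · intro h0
    have := congrArg Subtype.val h0
    simp [hf, hb] at this
  · have hS : a ^ (2 * m + 1) * (u : S) + b ^ (2 * m + 1) * v = 0 := by
      apply mul_left_cancel₀ (pow_ne_zero (2 * m + 1) hf)
      have := congrArg Subtype.val huv
      simp [mul_pow] at this
      linear_combination this
    obtain ⟨w, hw⟩ : a ^ (2 * m + 1) ∣ (v : S) :=
      pow_dvd_of_pow_dvd_pow_mul ha hab _ (2 * m + 1) ⟨-u, by linear_combination hS⟩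
    have hu : (u : S) = -(b ^ (2 * m + 1) * w) := by
      apply mul_left_cancel₀ (pow_ne_zero (2 * m + 1) ha)
      rw [hw] at hS
      linear_combination hS
    have hsub : 2 * m + 1 - m = m + 1 := by omega
    rw [hsub]
    refine ⟨mulAmalgamated k f (a ^ (m + 1) * b ^ (m + 1) * w), Subtype.ext ?_, Subtype.ext ?_⟩
    · simp [hu]
      ring
    · simp [hw]
      ring

theorem isParameterSequence_mulAmalgamated_pair {𝔪 Q : Ideal S} (h𝔪 : 𝔪 ≠ ⊤) (hf𝔪 : f ∈ 𝔪)
    (hf : f ≠ 0) (ha : a ≠ 0) (hb : b ≠ 0) (hab : ∀ x, a ∣ b * x → a ∣ x)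
    (hQ : Q.IsPrime) (hQ𝔪 : Q ≤ 𝔪) (haQ : a ∈ Q) (hbQ : b ∈ Q) (hfQ : f ∉ Q)
    (hspan : Ideal.span (Set.range ![mulAmalgamated k f a, mulAmalgamated k f b]) ≠ ⊤) :
    IsParameterSequence ![mulAmalgamated k f a, mulAmalgamated k f b] where
  span_ne_top := hspan
  weaklyProregular := isWeaklyProregular_mulAmalgamated_pair hf ha hb hab
  nontrivial_cech p _ hp := by
    have hap : mulAmalgamated k f a ∈ p := hp (Ideal.subset_span ⟨0, rfl⟩)
    have hbp : mulAmalgamated k f b ∈ p := hp (Ideal.subset_span ⟨1, rfl⟩)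
    -- Either p misses some element of fS and comes from S, or p contains fS = 𝔪 ∩ (k + fS) and
    -- hence the contraction of Q.
    obtain ⟨P, hP, haP, hbP, hfP, hPp⟩ : ∃ P : Ideal S, P.IsPrime ∧ a ∈ P ∧ b ∈ P ∧ f ∉ P ∧
        ∀ r : amalgamated k (Ideal.span {f}), (r : S) ∈ P → r ∈ p := by
      by_cases h : ∃ t, mulAmalgamated k f t ∉ p
      · obtain ⟨t, ht⟩ := h
        obtain ⟨P, hP, hfP, hPs, hPp⟩ := exists_prime_avoiding_of_notMem p ht
        exact ⟨P, hP, hPs a hap, hPs b hbp, hfP, hPp⟩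
      · push Not at h
        refine ⟨Q, hQ, haQ, hbQ, hfQ, fun r hr => ?_⟩
        obtain ⟨s, rfl⟩ := exists_eq_mulAmalgamated_of_mem h𝔪 hf𝔪 r (hQ𝔪 hr)
        exact h s
    refine nontrivial_localizedModule_cechCohomology _ p fun s hs N hmem => hs (hPp s ?_)
    have hr : Set.range (fun j => ![mulAmalgamated k f a, mulAmalgamated k f b] j ^ (N + 1)) =
        {mulAmalgamated k f a ^ (N + 1), mulAmalgamated k f b ^ (N + 1)} := by
      ext y
      simp [Fin.exists_fin_two, eq_comm]
    rw [hr, Ideal.mem_span_pair] at hmem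
    obtain ⟨u, v, huv⟩ := hmem
    have huv' := congrArg Subtype.val huv
    simp [Fin.prod_univ_two] at huv'
    -- The powers of f from (fa · fb)^N stay with s, so only f^(2N)s is seen to lie in (a, b); this
    -- is why P has to avoid f.
    obtain ⟨y, z, hyz⟩ := exists_eq_of_mul_pow_eq ha hab N (t := f ^ (2 * N) * s)
      (u := f ^ (N + 1) * u) (v := f ^ (N + 1) * v) (by linear_combination -huv')
    refine (hP.mem_or_mem (?_ : f ^ (2 * N) * (s : S) ∈ P)).resolve_left
      fun h => hfP (hP.mem_of_pow_mem _ h)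
    rw [hyz]
    exact P.add_mem (P.mul_mem_right _ haP) (P.mul_mem_right _ hbP)

/-- The element fas witnesses the failure: fb · fas = fa · fbs, but fas is a multiple of fa only
over S, since s is not in the subring. -/
theorem not_isRegular_mulAmalgamated_pair (hf : f ≠ 0) (ha : a ≠ 0)
    {s : S} (hs : s ∉ amalgamated k (Ideal.span {f})) :
    ¬ RingTheory.Sequence.IsRegular (amalgamated k (Ideal.span {f}))
      [mulAmalgamated k f a, mulAmalgamated k f b] := by
  intro h
  rw [RingTheory.Sequence.isRegular_cons_iff, RingTheory.Sequence.isRegular_cons_iff] at h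
  have := (isSMulRegular_quotient_iff_mem_of_smul_mem _ _).mp h.2.1 (mulAmalgamated k f (a * s))
    ⟨mulAmalgamated k f (b * s), trivial, Subtype.ext (by simp; ring)⟩
  obtain ⟨r, -, hr⟩ := this
  have hr' := congrArg Subtype.val hr
  simp at hr'
  refine hs ?_
  have : s = r := by
    apply mul_left_cancel₀ (mul_ne_zero hf ha)
    linear_combination -hr'
  rw [this]
  exact r.2

end Domain

end CohenMacaulay

/-! ### The main theorem. -/

open CohenMacaulay in
theorem theorem3p12 {k : Type u} {S : Type v} [Field k] [CommRing S] [IsDomain S] [Algebra k S]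
    [Algebra.EssFiniteType k S] (hS : CohenMacaulay.IsCohenMacaulayRing S)
    (f : S) (hf : f ≠ 0)
    (𝔪 : Ideal S) [𝔪.IsMaximal] (hf𝔪 : f ∈ 𝔪)
    (hdim : 3 ≤ ringKrullDim (Localization.AtPrime 𝔪)) :
    ¬ CohenMacaulay.IsHamiltonMarleyCohenMacaulay
        (CohenMacaulay.amalgamated k (Ideal.span {f})) := by
  intro hR
  have := hS.isNoetherianRing
  have h𝔪 : 𝔪 ≠ ⊤ := Ideal.IsPrime.ne_top'
  have hdepth : 2 ≤ localDepth (Localization.AtPrime 𝔪) := by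
    have h3 : (3 : WithBot ℕ∞) ≤ (localDepth (Localization.AtPrime 𝔪) : WithBot ℕ∞) := by
      rwa [hS.depth_eq_dim 𝔪]
    have h3' : (3 : ℕ∞) ≤ localDepth (Localization.AtPrime 𝔪) := WithBot.coe_le_coe.mp h3
    exact le_trans (by norm_num) h3'
  have hheight : 3 ≤ 𝔪.height := by
    rw [IsLocalization.AtPrime.ringKrullDim_eq_height 𝔪] at hdim
    exact WithBot.coe_le_coe.mp hdim
  obtain ⟨a, b, ha, hab, Q, hQ, hQ𝔪, haQ, hbQ, hfQ⟩ :=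
    exists_regular_pair_and_prime 𝔪 hdepth hheight hf hf𝔪
  -- If b = 0, regularity applied to 1 makes a a unit, although a lies in Q.
  have hb : b ≠ 0 := by
    rintro rfl
    exact hQ.ne_top ((Ideal.eq_top_iff_one _).mpr (Q.mem_of_dvd (hab 1 (by simp)) haQ))
  obtain ⟨s, hs⟩ : ∃ s : S, s ∉ amalgamated k (Ideal.span {f}) := by
    -- An inclusion 𝔪 ⊆ (f) would make 𝔪 minimal over one element, hence of height at most one.
    refine exists_notMem_amalgamated h𝔪 hf𝔪 fun hle => ?_
    have hmin : 𝔪 ∈ (Ideal.span {f}).minimalPrimes :=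
      ⟨⟨inferInstance, (Ideal.span_singleton_le_iff_mem _).mpr hf𝔪⟩, fun J hJ _ => hle.trans hJ.2⟩
    have := hheight.trans (Ideal.height_le_card_of_mem_minimalPrimes_span (Set.finite_singleton f)
      hmin)
    norm_num at this
  set x := ![mulAmalgamated k f a, mulAmalgamated k f b] with hx
  have hspan : ∀ {l : ℕ} (y : Fin l → amalgamated k (Ideal.span {f})), (∀ j, (y j : S) ∈ 𝔪) →
      Ideal.span (Set.range y) ≠ ⊤ := by
    intro l y hy htop
    have hle : Ideal.span (Set.range y) ≤
        𝔪.comap (amalgamated k (Ideal.span {f})).val.toRingHom := by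
      rw [Ideal.span_le]
      rintro _ ⟨j, rfl⟩
      exact hy j
    rw [htop, top_le_iff] at hle
    exact Ideal.comap_ne_top _ h𝔪 hle
  have hx𝔪 : ∀ j, (x j : S) ∈ 𝔪 := by
    rw [Fin.forall_fin_two]
    exact ⟨𝔪.mul_mem_right _ hf𝔪, 𝔪.mul_mem_right _ hf𝔪⟩
  have hstrong : IsStrongParameterSequence x := by
    intro i hi hi1
    obtain rfl | rfl : i = 1 ∨ i = 2 := by omega
    · refine isParameterSequence_of_domain_one _ (fun h0 => ?_) (hspan _ fun j => hx𝔪 _)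
      exact mul_ne_zero hf ha (congrArg Subtype.val h0)
    · exact isParameterSequence_mulAmalgamated_pair h𝔪 hf𝔪 hf ha hb hab hQ hQ𝔪 haQ hbQ hfQ
        (hspan _ hx𝔪)
  have hreg := hR 2 x (by norm_num) hstrong
  rw [hx, List.ofFn_succ, List.ofFn_succ, List.ofFn_zero] at hreg
  exact not_isRegular_mulAmalgamated_pair hf ha hs hreg
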